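/- Let $\alpha\in(0,1)$ be irrational with continued fraction expansion $\alpha=[0;1+d_1,d_2,d_3,\ldots]$, where all $d_i\ge 1$. Write $a_1=1+d_1$ and $a_i=d_i$ for $i\ge 2$, and let $q_0=1$, $q_1=a_1$, $q_n=a_nq_{n-1}+q_{n-2}$ $(n\ge2)$. For $n\ge0$ and an integer $k\ge 1-a_{n+1}$ put $\alpha_{n,k}=[0;a_{n+1}+k,a_{n+2},a_{n+3},\ldots]$. For irrational $\gamma\in(0,1)$ the characteristic Sturmian word $c_\gamma$ is the infinite word over $\{a,b\}$ whose $i$-th letter $(i\ge1)$ is $a$ if $\lfloor (i+1)\gamma\rfloor=\lfloor i\gamma\rfloor$ and $b$ otherwise. A sequence is said to be given by $c_\gamma$ over the alphabet $\{x,y\}$ if it is obtained from $c_\gamma$ by replacing $a$ by $x$ and $b$ by $y$. Define words by $s_{-1}=b$, $s_0=a$, $s_n=s_{n-1}^{d_n}s_{n-2}$ for $n\ge1$; $w_{-2}=v_{-2}=\varepsilon$, $w_{-1}=a$; $w_n=as_nb^{-1}$ for odd $n\ge 0$ and $w_n=bs_na^{-1}$ for even $n\ge0$; and, for $n\ge-1$,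 $v_n=as_{n+1}^{d_{n+2}-1}s_nb^{-1}$ if $n$ is odd and $v_n=bs_{n+1}^{d_{n+2}-1}s_na^{-1}$ if $n$ is even (here $zx^{-1}$ is $z$ with its last letter $x$ removed). For $n\ge0$ and $0\le k\le d_{n+1}-1$ let $$U_{n,k}=(w_{n-1}v_{n-2})^kw_{n-1},\qquad \overline U_{n,k}=(v_{n-2}w_{n-1})^kv_{n-2}.$$ Let $\tilde v$ denote the reversal of $v$, and let $\mathrm{occ}_i(u)$ $(i\ge1)$ be the position (counted from $0$) in $c_\alpha$ of the $i$-th occurrence of $u$ in $c_\alpha$. Let $u$ be a palindromic factor of $c_\alpha$ with $|u|\ge2$. (1) Suppose $u=vU_{n,k}\tilde v$ for some $n\ge1$, where $v$ is a suffix of $v_{n-2}$, $v\ne v_{n-2}$, and $0\le k\le d_{n+1}-2$. Then $\mathrm{occ}_1(u)=\frac12\big((k+2)q_n+q_{n-1}-|u|-2\big)$ and $\mathrm{occ}_{i+1}(u)=\mathrm{occ}_i(u)+P_i$ for all $i\ge1$, where $(P_i)_{i\ge1}$ is given by $c_{\alpha_{n,-k}}$ over the alphabet $\{q_n,(k+1)q_n+q_{n-1}\}$.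 (2) Suppose $u=v\overline U_{n,k}\tilde v$ for some $n\ge1$, where $v$ is a suffix of $w_{n-1}$, $v\ne w_{n-1}$, and $0\le k\le d_{n+1}-1$. Then $\mathrm{occ}_1(u)=\frac12\big((k+1)q_n+q_{n-1}-|u|-2\big)$ and $\mathrm{occ}_{i+1}(u)=\mathrm{occ}_i(u)+P_i$ for all $i\ge1$, where $(P_i)_{i\ge1}$ is given by $c_{\alpha_{n,1-k}}$ over the alphabet $\{q_n,kq_n+q_{n-1}\}$. Moreover, if $u=a^k$ for some $k\in[2,d_1-1]$, then $\mathrm{occ}_1(u)=0$ and $\mathrm{occ}_{i+1}(u)=\mathrm{occ}_i(u)+P_i$ for all $i\ge1$, where $(P_i)_{i\ge1}$ is given by $c_{\alpha_{0,-k}}$ over the alphabet $\{1,k+1\}$. -/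

import Mathlib

namespace Sturmian

/-! Continued fractions `γ = [0; a₁, a₂, a₃, …]` of irrational numbers `γ ∈ (0, 1)`. -/

/-- The Gauss map `x ↦ 1/x - ⌊1/x⌋`; its `n`-th iterate sends `[0; a₁, a₂, …]` to
`[0; aₙ₊₁, aₙ₊₂, …]`. -/
noncomputable def gauss (x : ℝ) : ℝ := Int.fract x⁻¹

/-- The `n`-th partial quotient `aₙ` (`n ≥ 1`) of `γ = [0; a₁, a₂, …]`. -/
noncomputable def quot (γ : ℝ) (n : ℕ) : ℕ := ⌊(gauss^[n - 1] γ)⁻¹⌋₊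

/-- The number `γ_{n,k} = [0; aₙ₊₁ + k, aₙ₊₂, aₙ₊₃, …]`, where `γ = [0; a₁, a₂, …]` and
`k ≥ 1 - aₙ₊₁`. -/
noncomputable def shift (γ : ℝ) (n : ℕ) (k : ℤ) : ℝ :=
  ((quot γ (n + 1) : ℝ) + (k : ℝ) + gauss^[n + 1] γ)⁻¹

/-- The denominators `qₙ` of the convergents: `q₀ = 1`, `q₁ = a₁`, `qₙ = aₙ qₙ₋₁ + qₙ₋₂`. -/
noncomputable def den (γ : ℝ) : ℕ → ℕ
  | 0 => 1
  | 1 => quot γ 1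
  | n + 2 => quot γ (n + 2) * den γ (n + 1) + den γ n

/-- The directive sequence `(d₁, d₂, …)` of `α = [0; 1 + d₁, d₂, d₃, …]`. -/
noncomputable def directive (α : ℝ) (n : ℕ) : ℕ :=
  if n = 1 then quot α 1 - 1 else quot α n

theorem gauss_mem {x : ℝ} (hx : Irrational x) :
    Irrational (gauss x) ∧ 0 < gauss x ∧ gauss x < 1 := by
  have h : Irrational (gauss x) := by
    have := hx.inv.sub_intCast ⌊x⁻¹⌋
    rwa [Int.self_sub_floor] at this
  exact ⟨h, lt_of_le_of_ne (Int.fract_nonneg _) h.ne_zero.symm, Int.fract_lt_one _⟩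

theorem gauss_iterate_irrational {x : ℝ} (hx : Irrational x) (n : ℕ) :
    Irrational (gauss^[n] x) := by
  induction n with
  | zero => simpa using hx
  | succ n ih => rw [Function.iterate_succ_apply']; exact (gauss_mem ih).1

/-- The partial quotients above are those of Mathlib's continued fraction expansion. -/
theorem genContFract_get {γ : ℝ} (hγ : Irrational γ) (h0 : 0 < γ) (h1 : γ < 1) (n : ℕ) :
    (GenContFract.of γ).s.get? n = some ⟨1, (quot γ (n + 1) : ℝ)⟩ := by
  have key : ∀ (n : ℕ) (v : ℝ), Irrational v →
      (GenContFract.of v).s.get? n = some ⟨1, (⌊(gauss^[n] (Int.fract v))⁻¹⌋ : ℝ)⟩ := by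
    intro n
    induction n with
    | zero =>
      intro v hv
      have hf : Irrational (Int.fract v) := by
        have := hv.sub_intCast ⌊v⌋
        rwa [Int.self_sub_floor] at this
      exact GenContFract.of_s_head hf.ne_zero
    | succ n ih =>
      intro v hv
      have hf : Irrational (Int.fract v) := by
        have := hv.sub_intCast ⌊v⌋
        rwa [Int.self_sub_floor] at this
      rw [GenContFract.of_s_succ, ih _ hf.inv, Function.iterate_succ_apply]
      rfl
  rw [key n γ hγ, Int.fract_eq_self.2 ⟨h0.le, h1⟩]
  have hpos : 0 ≤ gauss^[n] γ := by
    cases n with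
    | zero => simpa using h0.le
    | succ n => rw [Function.iterate_succ_apply']; exact Int.fract_nonneg _
  have : (⌊(gauss^[n] γ)⁻¹⌋ : ℝ) = (⌊(gauss^[n] γ)⁻¹⌋₊ : ℝ) :=
    (natCast_floor_eq_intCast_floor (inv_nonneg.2 hpos)).symm
  simp only [quot, Nat.add_sub_cancel, this]

/-- `γ_{n,k}` is an irrational number in `(0, 1)` with partial quotients
`aₙ₊₁ + k, aₙ₊₂, aₙ₊₃, …`. -/
theorem shift_spec {γ : ℝ} (hγ : Irrational γ) (n : ℕ) (k : ℤ)
    (hk : 1 ≤ (quot γ (n + 1) : ℤ) + k) :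
    Irrational (shift γ n k) ∧ 0 < shift γ n k ∧ shift γ n k < 1 ∧
      (quot (shift γ n k) 1 : ℤ) = quot γ (n + 1) + k ∧
      ∀ i, quot (shift γ n k) (i + 2) = quot γ (n + i + 2) := by
  obtain ⟨m, hm⟩ : ∃ m : ℕ, (m : ℤ) = (quot γ (n + 1) : ℤ) + k :=
    ⟨((quot γ (n + 1) : ℤ) + k).toNat, Int.toNat_of_nonneg (by omega)⟩
  have hm' : (quot γ (n + 1) : ℝ) + (k : ℝ) = (m : ℝ) := by exact_mod_cast hm.symm
  have hm1 : (1 : ℝ) ≤ m := by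
    have : (1 : ℤ) ≤ m := by omega
    exact_mod_cast this
  have hs : shift γ n k = ((m : ℝ) + gauss^[n + 1] γ)⁻¹ := by rw [shift, hm']
  obtain ⟨ht, ht0, ht1⟩ := gauss_mem (gauss_iterate_irrational hγ n)
  rw [← Function.iterate_succ_apply' gauss n γ] at ht ht0 ht1
  have hg : gauss (shift γ n k) = gauss^[n + 1] γ := by
    rw [gauss, hs, inv_inv, Int.fract_natCast_add]
    exact Int.fract_eq_self.2 ⟨ht0.le, ht1⟩
  refine ⟨?_, ?_, ?_, ?_, ?_⟩
  · rw [hs]; exact (ht.natCast_add m).inv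
  · rw [hs]; positivity
  · rw [hs]; exact inv_lt_one_of_one_lt₀ (by linarith)
  · rw [← hm]
    have : quot (shift γ n k) 1 = m := by
      simp only [quot, Nat.sub_self, Function.iterate_zero, id]
      rw [hs, inv_inv, Nat.floor_eq_iff (by positivity)]
      constructor <;> linarith
    rw [this]
  · intro i
    have e1 : i + 2 - 1 = i + 1 := rfl
    have e2 : n + i + 2 - 1 = i + (n + 1) := by omega
    simp only [quot, e1, e2]
    rw [Function.iterate_succ_apply, hg, Function.iterate_add_apply gauss i (n + 1)]

/-! Words over the alphabet `{a, b}`; infinite words are functions on `ℕ`. -/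

/-- The two-letter alphabet `{a, b}`. -/
inductive Letter : Type
  | a : Letter
  | b : Letter

/-- The word `w ^ k`. -/
def wpow (w : List Letter) (k : ℕ) : List Letter := (List.replicate k w).flatten

/-- The finite word `u` occurs at position `p` of the infinite word `x`. -/
def OccursAt (x : ℕ → Letter) (u : List Letter) (p : ℕ) : Prop :=
  (List.range u.length).map (fun i => x (p + i)) = u

/-- The finite word `u` is a factor of the infinite word `x`. -/
def IsFactor (x : ℕ → Letter) (u : List Letter) : Prop := ∃ p, OccursAt x u p

/-- The position of the `i`-th occurrence (`i ≥ 1`) of `u` in `x`. -/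
noncomputable def occ (x : ℕ → Letter) (u : List Letter) (i : ℕ) : ℕ :=
  Nat.nth (OccursAt x u) (i - 1)

/-- The lower mechanical word `s_{α,0}` of slope `α` and intercept `0`. -/
noncomputable def mechWord (α : ℝ) (n : ℕ) : Letter :=
  if ⌊((n : ℝ) + 1) * α⌋ - ⌊(n : ℝ) * α⌋ = 0 then Letter.a else Letter.b

/-- The characteristic Sturmian word `c_α`, given by `s_{α,0} = a c_α`. -/
noncomputable def charWord (α : ℝ) (n : ℕ) : Letter := mechWord α (n + 1)

/-- `GivenBy P γ x y`: the sequence `(P_i)_{i ≥ 1}` is `c_γ` over the alphabet `{x, y}`, i.e. it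
is obtained from `c_γ` on replacing the letter `a` by `x` and the letter `b` by `y`. -/
def GivenBy (P : ℕ → ℕ) (γ : ℝ) (x y : ℕ) : Prop :=
  ∀ i, 1 ≤ i → P i =
    match charWord γ (i - 1) with
    | Letter.a => x
    | Letter.b => y

/-- The standard sequence, indexed from `-1`: `stdWord d m` is `s_{m-1}`, where
`s₋₁ = b`, `s₀ = a`, `sₙ = sₙ₋₁ ^ dₙ sₙ₋₂`. -/
def stdWord (d : ℕ → ℕ) : ℕ → List Letter
  | 0 => [Letter.b]
  | 1 => [Letter.a]
  | m + 2 => wpow (stdWord d (m + 1)) (d (m + 1)) ++ stdWord d m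

/-- `s_{m-1}` ends in `b` if `m` is even (`m - 1` odd) and in `a` otherwise. Hence `dropLast` in the
two definitions below is multiplication by `b⁻¹` and by `a⁻¹` respectively. -/
theorem stdWord_eq_append (d : ℕ → ℕ) (m : ℕ) :
    stdWord d m = (stdWord d m).dropLast ++ [if Even m then Letter.b else Letter.a] := by
  suffices h : ∃ z, stdWord d m = z ++ [if Even m then Letter.b else Letter.a] by
    obtain ⟨z, hz⟩ := h
    rw [hz, List.dropLast_concat]
  induction m using Nat.strong_induction_on with
  | _ m ih =>
    match m, ih with
    | 0, _ => exact ⟨[], by simp [stdWord]⟩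
    | 1, _ => exact ⟨[], by simp [stdWord]⟩
    | m + 2, ih =>
      obtain ⟨z, hz⟩ := ih m (by omega)
      refine ⟨wpow (stdWord d (m + 1)) (d (m + 1)) ++ z, ?_⟩
      have : Even (m + 2) ↔ Even m := by simp [Nat.even_add]
      simp only [stdWord, this, List.append_assoc]
      rw [← hz]

/-- The singular words, indexed from `-2`: `singWord d m` is `w_{m-2}`, where `w₋₂ = ε`, `w₋₁ = a`,
and `wₙ = a sₙ b⁻¹` for odd `n`, `wₙ = b sₙ a⁻¹` for even `n`. -/
def singWord (d : ℕ → ℕ) : ℕ → List Letter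
  | 0 => []
  | m + 1 => (if Even m then Letter.a else Letter.b) :: (stdWord d m).dropLast

/-- The adjoining singular words, indexed from `-2`: `adjWord d m` is `v_{m-2}`, where `v₋₂ = ε`
and, for `n ≥ -1`, `vₙ = a sₙ₊₁ ^ (dₙ₊₂ - 1) sₙ b⁻¹` for odd `n` and
`vₙ = b sₙ₊₁ ^ (dₙ₊₂ - 1) sₙ a⁻¹` for even `n`. -/
def adjWord (d : ℕ → ℕ) : ℕ → List Letter
  | 0 => []
  | m + 1 => (if Even m then Letter.a else Letter.b) ::
      (wpow (stdWord d (m + 1)) (d (m + 1) - 1) ++ stdWord d m).dropLast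

/-- The palindrome `U_{n,k} = (wₙ₋₁ vₙ₋₂) ^ k wₙ₋₁`. -/
def U (d : ℕ → ℕ) (n k : ℕ) : List Letter :=
  wpow (singWord d (n + 1) ++ adjWord d n) k ++ singWord d (n + 1)

/-- The palindrome `Ū_{n,k} = (vₙ₋₂ wₙ₋₁) ^ k vₙ₋₂`. -/
def Ubar (d : ℕ → ℕ) (n k : ℕ) : List Letter :=
  wpow (adjWord d n ++ singWord d (n + 1)) k ++ adjWord d n

end Sturmian

/-!
The occurrences of a palindromic factor of `c_α` are found by counting lattice points in a strip.

A factor of length `L` at position `p` of `c_α` is the coding of the rotation by `α` started at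
`(p + 1) α`. Cut it after `i₀` letters and put `L = i₀ + j₀`. As a function of the point
`N α mod 1` at the cut, `N = p + 1 + i₀`, it changes exactly at the points `-i α` with
`-i₀ ≤ i ≤ j₀`. Let `(q, p)` and `(f, m)` be a basis of `ℤ²` whose vectors lie on opposite sides of the
line of slope `α`, at vertical distances `A` and `B` from it, and suppose that `j₀ - i₀ = f - q` and
`i₀ < q`. The lattice point `s (q, p) + t (f, m)` lies inside a strip of width `A + B` exactly when
`0 < s A - t B < A + B`, and then its first coordinate is at least `q > i₀` or at most `-f < -j₀`.
So no discontinuity is inside the strip, and all its positions carry the same factor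
(`occursAt_of_strip`). Conversely, a factor for which the window between the cuts `i₀` and `j₀`
contains the right number of letters `b` occurs only at positions of the strip (`exists_strip`),
so that the factor itself never has to be computed letter by letter. For each `i = s + t ≥ 1` the
strip contains one lattice point, with `t = ⌊i γ⌋` and `γ = A / (A + B)` (`strip_iff_exists`).
The first coordinates `i q + ⌊i γ⌋ (f - q)` start from `q`, and their gaps are `c_γ` over `{q, f}`
(`occ_of_unimodular`).

It remains to choose the basis. For `U_{n,k}` in the middle of the palindrome it is
`(qₙ, pₙ)`, `((k + 1) qₙ + qₙ₋₁, (k + 1) pₙ + pₙ₋₁)`, with `i₀` the length of the outer part; lengths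
and numbers of letters `b` follow from `|sₙ| = qₙ` and `|sₙ|_b = pₙ`, and `γ = α_{n,-k}` from the
recursion for `|qₙ α - pₙ|` (`occ_of_U_mid`). Since `Ū_{n,k+1} = vₙ₋₂ U_{n,k} vₙ₋₂`, this also
covers `Ū_{n,k}` for `k ≥ 1`. For `Ū_{n,0} = vₙ₋₂` the basis is `(qₙ, pₙ)`, `(qₙ₋₁, pₙ₋₁)`
(`occ_of_adjWord_mid`), and for `a ^ k` it is `(1, 0)`, `(k + 1, 1)` (`occ_replicate_a`).
-/

namespace Sturmian

/-! ### Counting letters of factors -/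

/-- The weight of a letter: `1` for `b` and `0` for `a`. -/
def Letter.weight : Letter → ℤ
  | .a => 0
  | .b => 1

/-- The weight of a word: the number of its letters `b`, as an integer. -/
def weight (w : List Letter) : ℤ := (w.map Letter.weight).sum

theorem weight_append (w z : List Letter) : weight (w ++ z) = weight w + weight z := by
  simp [weight]

theorem weight_cons (c : Letter) (w : List Letter) : weight (c :: w) = c.weight + weight w := by
  simp [weight]

theorem weight_wpow (w : List Letter) (k : ℕ) : weight (wpow w k) = k * weight w := by
  induction k with
  | zero => simp [wpow, weight]
  | succ k ih =>
    have : wpow w (k + 1) = w ++ wpow w k := by simp [wpow, List.replicate_succ]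
    rw [this, weight_append, ih]
    push_cast
    ring

theorem length_wpow (w : List Letter) (k : ℕ) : (wpow w k).length = k * w.length := by
  simp [wpow]

theorem floor_add_sub_floor_mem {γ : ℝ} (h0 : 0 < γ) (h1 : γ < 1) (x : ℝ) :
    ⌊x + γ⌋ - ⌊x⌋ = 0 ∨ ⌊x + γ⌋ - ⌊x⌋ = 1 := by
  have h2 : ⌊x⌋ ≤ ⌊x + γ⌋ := Int.floor_mono (by linarith)
  have h3 : ⌊x + γ⌋ < ⌊x⌋ + 2 := by
    rw [Int.floor_lt]
    push_cast
    linarith [Int.lt_floor_add_one x]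
  omega

theorem weight_charWord {α : ℝ} (h0 : 0 < α) (h1 : α < 1) (n : ℕ) :
    (charWord α n).weight = ⌊((n + 2 : ℕ) : ℝ) * α⌋ - ⌊((n + 1 : ℕ) : ℝ) * α⌋ := by
  have e : ((n + 2 : ℕ) : ℝ) * α = ((n + 1 : ℕ) : ℝ) * α + α := by push_cast; ring
  have e2 : (((n + 1 : ℕ) : ℝ) + 1) * α = ((n + 1 : ℕ) : ℝ) * α + α := by ring
  rw [e, charWord, mechWord, e2]
  rcases floor_add_sub_floor_mem h0 h1 (((n + 1 : ℕ) : ℝ) * α) with h | h <;> rw [h] <;> rfl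

/-- The number of letters `b` in a factor of `c_α` is a difference of Beatty numbers. -/
theorem OccursAt.weight_eq {α : ℝ} (h0 : 0 < α) (h1 : α < 1) {u : List Letter} {p : ℕ}
    (h : OccursAt (charWord α) u p) :
    weight u = ⌊((p + u.length + 1 : ℕ) : ℝ) * α⌋ - ⌊((p + 1 : ℕ) : ℝ) * α⌋ := by
  have key : ∀ L : ℕ, weight ((List.range L).map fun i => charWord α (p + i)) =
      ⌊((p + L + 1 : ℕ) : ℝ) * α⌋ - ⌊((p + 1 : ℕ) : ℝ) * α⌋ := by
    intro L
    induction L with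
    | zero => simp [weight]
    | succ L ih =>
      rw [List.range_succ, List.map_append, weight_append, ih]
      simp only [List.map_cons, List.map_nil, weight_cons, weight_charWord h0 h1]
      have : weight [] = 0 := rfl
      rw [this, show p + L + 2 = p + (L + 1) + 1 by ring]
      ring
  conv_lhs => rw [← h]
  exact key _

theorem OccursAt.append_left {x : ℕ → Letter} {v w : List Letter} {p : ℕ}
    (h : OccursAt x (v ++ w) p) : OccursAt x v p := by
  unfold OccursAt at h ⊢
  rw [List.length_append, List.range_add, List.map_append] at h
  exact (List.append_inj h (by simp)).1

theorem OccursAt.append_right {x : ℕ → Letter} {v w : List Letter} {p : ℕ}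
    (h : OccursAt x (v ++ w) p) : OccursAt x w (p + v.length) := by
  unfold OccursAt at h ⊢
  rw [List.length_append, List.range_add, List.map_append] at h
  have := (List.append_inj h (by simp)).2
  rw [List.map_map] at this
  simpa [Function.comp_def, add_assoc] using this

/-- Two positions carry the same factor of length `L` once their Beatty numbers differ by a
constant along that window. -/
theorem OccursAt.of_floor_eq {α : ℝ} {u : List Letter} {p r : ℕ} {c : ℤ}
    (h : OccursAt (charWord α) u r)
    (hc : ∀ i ≤ u.length, ⌊((p + i + 1 : ℕ) : ℝ) * α⌋ = ⌊((r + i + 1 : ℕ) : ℝ) * α⌋ + c) :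
    OccursAt (charWord α) u p := by
  unfold OccursAt at h ⊢
  conv_rhs => rw [← h]
  apply List.map_congr_left
  intro i hi
  rw [List.mem_range] at hi
  have e : ∀ n : ℕ, (((n + 1 : ℕ) : ℝ) + 1) * α = ((n + 1 + 1 : ℕ) : ℝ) * α := by
    intro n; push_cast; ring
  have h1 := hc i hi.le
  have h2 := hc (i + 1) hi
  simp only [charWord, mechWord, e]
  rw [← add_assoc, ← add_assoc] at h2
  rw [h1, h2]
  congr 2
  ring

/-! ### Lattice points in a strip -/

section Strip

variable {α : ℝ} {q f : ℕ} {pm fm σ : ℤ}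

/-- Coordinates of a lattice point with respect to the basis `(q, pm)`, `(f, fm)`. -/
theorem lattice_coordinates (hσ : σ * σ = 1) (hdet : q * fm - pm * f = σ) (N m : ℤ) :
    ∃ s t : ℤ, N = s * q + t * f ∧
      (σ : ℝ) * (N * α - m) = s * (σ * (q * α - pm)) - t * (σ * (fm - f * α)) := by
  have hN : N = σ * (N * fm - m * f) * q + σ * (q * m - pm * N) * f := by
    linear_combination (-N) * hσ - σ * N * hdet
  have hm : m = σ * (N * fm - m * f) * pm + σ * (q * m - pm * N) * fm := by
    linear_combination (-m) * hσ - σ * m * hdet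
  refine ⟨_, _, hN, ?_⟩
  have hN' := congrArg (Int.cast : ℤ → ℝ) hN
  have hm' := congrArg (Int.cast : ℤ → ℝ) hm
  push_cast at hN' hm' ⊢
  linear_combination (σ : ℝ) * α * hN' - σ * hm'

/-- Let two lattice vectors lie at heights `A` and `-B`. An integral combination with coefficients
`s` and `t` that lies inside the strip of heights between `0` and `A + B` has first coordinate
either at least that of the first vector, or at most minus that of the second. -/
theorem lattice_dichotomy {A B : ℝ} (hA : 0 < A) (hB : 0 < B) {s t : ℤ}
    (hlo : 0 < s * A - t * B) (hhi : s * A - t * B < A + B) :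
    (1 ≤ s ∧ 0 ≤ t) ∨ (s ≤ 0 ∧ t ≤ -1) := by
  rcases le_or_gt 0 t with ht | ht
  · left
    refine ⟨?_, ht⟩
    by_contra! hs
    have h1 : (s : ℝ) ≤ 0 := by exact_mod_cast (by omega : s ≤ 0)
    have h2 : (0 : ℝ) ≤ t := by exact_mod_cast ht
    nlinarith
  · right
    refine ⟨?_, by omega⟩
    by_contra! hs
    have h1 : (1 : ℝ) ≤ s := by exact_mod_cast (by omega : 1 ≤ s)
    have h2 : (t : ℝ) ≤ -1 := by exact_mod_cast (by omega : t ≤ -1)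
    nlinarith

/-- The points `-iα` with `-i₀ ≤ i ≤ j₀`, at which a factor of length `i₀ + j₀` read around a cut
at `i₀` changes, all lie outside the interior of the strip. Hence all the positions in the strip
carry the same factor. -/
theorem occursAt_of_strip (hσ : σ = 1 ∨ σ = -1) (hirr : Irrational α)
    (hA : 0 < (σ : ℝ) * (q * α - pm)) (hB : 0 < (σ : ℝ) * (fm - f * α))
    (hdet : q * fm - pm * f = σ) {i₀ j₀ : ℕ} (hi : i₀ < q) (hij : i₀ + f = j₀ + q)
    {u : List Letter} (hu : u.length = i₀ + j₀) {p r : ℕ} {m n : ℤ}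
    (hr : OccursAt (charWord α) u r)
    (hr0 : 0 < (σ : ℝ) * ((r + 1 + i₀ : ℕ) * α - n))
    (hr1 : (σ : ℝ) * ((r + 1 + i₀ : ℕ) * α - n) < σ * (q * α - pm) + σ * (fm - f * α))
    (hp0 : 0 < (σ : ℝ) * ((p + 1 + i₀ : ℕ) * α - m))
    (hp1 : (σ : ℝ) * ((p + 1 + i₀ : ℕ) * α - m) < σ * (q * α - pm) + σ * (fm - f * α)) :
    OccursAt (charWord α) u p := by
  have hσσ : σ * σ = 1 := by rcases hσ with h | h <;> simp [h]
  -- the first coordinate of a lattice point of the strip is at least `q > i₀` or at most `-f < -j₀`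
  have nolat : ∀ N c : ℤ, -(j₀ : ℤ) ≤ N → N ≤ i₀ → 0 < (σ : ℝ) * (N * α - c) →
      (σ : ℝ) * (N * α - c) < σ * (q * α - pm) + σ * (fm - f * α) → False := by
    intro N c hN1 hN2 hc0 hc1
    obtain ⟨s, t, hN, hst⟩ := lattice_coordinates (α := α) hσσ hdet N c
    rw [hst] at hc0 hc1
    rcases lattice_dichotomy hA hB hc0 hc1 with ⟨hs, ht⟩ | ⟨hs, ht⟩
    · have h1 : (1 : ℤ) * q ≤ s * q := by gcongr
      have h2 : 0 ≤ t * f := by positivity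
      omega
    · have h1 : s * q ≤ 0 := mul_nonpos_of_nonpos_of_nonneg hs (by positivity)
      have h2 : t * f ≤ (-1) * f := by gcongr
      omega
  -- if two floors differ, the integer between them gives a lattice point of the strip
  have sep : ∀ (p r : ℕ) (m n : ℤ) (i : ℕ), i ≤ u.length →
      0 < (σ : ℝ) * ((r + 1 + i₀ : ℕ) * α - n) →
      (σ : ℝ) * ((r + 1 + i₀ : ℕ) * α - n) < σ * (q * α - pm) + σ * (fm - f * α) →
      0 < (σ : ℝ) * ((p + 1 + i₀ : ℕ) * α - m) →
      (σ : ℝ) * ((p + 1 + i₀ : ℕ) * α - m) < σ * (q * α - pm) + σ * (fm - f * α) →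
      ⌊((p + i + 1 : ℕ) : ℝ) * α⌋ - m ≤ ⌊((r + i + 1 : ℕ) : ℝ) * α⌋ - n := by
    intro p r m n i hiu hr0 hr1 hp0 hp1
    by_contra! hlt
    set c := ⌊((p + i + 1 : ℕ) : ℝ) * α⌋ - m with hc
    have hcp : (c : ℝ) < (p + i + 1 : ℕ) * α - m := by
      have h1 := Int.floor_le (((p + i + 1 : ℕ) : ℝ) * α)
      have h2 : ((⌊((p + i + 1 : ℕ) : ℝ) * α⌋ : ℤ) : ℝ) ≠ (p + i + 1 : ℕ) * α :=
        ((hirr.natCast_mul (Nat.succ_ne_zero (p + i))).ne_int _).symm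
      have h3 := lt_of_le_of_ne h1 h2
      rw [hc]
      push_cast at h3 ⊢
      linarith
    have hcr : (r + i + 1 : ℕ) * α - n < (c : ℝ) := by
      have h1 := Int.lt_floor_add_one (((r + i + 1 : ℕ) : ℝ) * α)
      have h2 : ((⌊((r + i + 1 : ℕ) : ℝ) * α⌋ - n + 1 : ℤ) : ℝ) ≤ c := by exact_mod_cast hlt
      push_cast at h1 h2 ⊢
      linarith
    apply nolat ((i₀ : ℤ) - i) (-c) (by omega) (by omega)
    all_goals
      push_cast at *
      rcases hσ with rfl | rfl <;> push_cast at * <;> nlinarith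
  refine hr.of_floor_eq (c := m - n) fun i hiu => ?_
  have h1 := sep p r m n i hiu hr0 hr1 hp0 hp1
  have h2 := sep r p n m i hiu hp0 hp1 hr0 hr1
  omega

/-- If the (signed) number of letters `b` from the cut `i₀` to the cut `j₀` is `fm - pm - σ`, then
the cut `i₀` is at a lattice point of the strip. No bound on the width of the strip is needed, and
`j₀ < i₀` is allowed. -/
theorem exists_strip (hσ : σ = 1 ∨ σ = -1) (hirr : Irrational α)
    {i₀ j₀ : ℕ} (hij : i₀ + f = j₀ + q) {p : ℕ}
    (hW : ⌊((p + 1 + j₀ : ℕ) : ℝ) * α⌋ - ⌊((p + 1 + i₀ : ℕ) : ℝ) * α⌋ = fm - pm - σ) :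
    ∃ m : ℤ, 0 < (σ : ℝ) * ((p + 1 + i₀ : ℕ) * α - m) ∧
      (σ : ℝ) * ((p + 1 + i₀ : ℕ) * α - m) < σ * (q * α - pm) + σ * (fm - f * α) := by
  have hlo : ∀ k : ℕ, ((⌊((p + 1 + k : ℕ) : ℝ) * α⌋ : ℤ) : ℝ) < (p + 1 + k : ℕ) * α := by
    intro k
    refine lt_of_le_of_ne (Int.floor_le _) ?_
    exact ((hirr.natCast_mul (by omega : p + 1 + k ≠ 0)).ne_int _).symm
  have hhi : ∀ k : ℕ, ((p + 1 + k : ℕ) : ℝ) * α < ⌊((p + 1 + k : ℕ) : ℝ) * α⌋ + 1 :=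
    fun k => Int.lt_floor_add_one _
  have hW' := congrArg (Int.cast : ℤ → ℝ) hW
  have hij' := congrArg (fun n : ℕ => (n : ℝ) * α) hij
  have a1 := hlo i₀
  have a2 := hhi i₀
  have b1 := hlo j₀
  have b2 := hhi j₀
  rcases hσ with rfl | rfl
  · refine ⟨⌊((p + 1 + i₀ : ℕ) : ℝ) * α⌋, ?_, ?_⟩ <;> push_cast at * <;> linarith
  · refine ⟨⌊((p + 1 + i₀ : ℕ) : ℝ) * α⌋ + 1, ?_, ?_⟩ <;> push_cast at * <;> linarith

/-- The positions carried by the strip: for each `i ≥ 1` exactly one lattice point, with first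
coordinate `i q + ⌊i γ⌋ (f - q)`. -/
theorem strip_iff_exists (hσ : σ = 1 ∨ σ = -1)
    (hA : 0 < (σ : ℝ) * (q * α - pm)) (hB : 0 < (σ : ℝ) * (fm - f * α))
    (hdet : q * fm - pm * f = σ) {γ : ℝ} (hγ : Irrational γ)
    (hγA : γ * (σ * (q * α - pm) + σ * (fm - f * α)) = σ * (q * α - pm)) {N : ℤ} (hN : 0 < N) :
    (∃ m : ℤ, 0 < (σ : ℝ) * (N * α - m) ∧
      (σ : ℝ) * (N * α - m) < σ * (q * α - pm) + σ * (fm - f * α)) ↔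
    ∃ j : ℕ, N = ((j + 1 : ℕ) : ℤ) * q + ⌊((j + 1 : ℕ) : ℝ) * γ⌋ * (f - q) := by
  have hσσ : σ * σ = 1 := by rcases hσ with h | h <;> simp [h]
  constructor
  · rintro ⟨m, h0, h1⟩
    obtain ⟨s, t, hst, hm⟩ := lattice_coordinates (α := α) hσσ hdet N m
    rw [hm] at h0 h1
    rcases lattice_dichotomy hA hB h0 h1 with ⟨hs, ht⟩ | ⟨hs, ht⟩
    · refine ⟨(s + t - 1).toNat, ?_⟩
      have e : (((s + t - 1).toNat + 1 : ℕ) : ℤ) = s + t := by omega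
      have e' : (((s + t - 1).toNat + 1 : ℕ) : ℝ) = s + t := by exact_mod_cast e
      rw [e, e']
      have : ⌊((s : ℝ) + t) * γ⌋ = t := by
        rw [Int.floor_eq_iff]
        generalize (σ : ℝ) * (q * α - pm) = A at *
        generalize (σ : ℝ) * (fm - f * α) = B at *
        have hAB : 0 < A + B := by linarith
        have hs' : ((s : ℝ) + t) * γ * (A + B) = (s + t) * A := by rw [mul_assoc, hγA]
        constructor
        · refine le_of_mul_le_mul_right ?_ hAB
          linarith
        · refine lt_of_mul_lt_mul_right ?_ hAB.le
          linarith
      rw [this, hst]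
      ring
    · exfalso
      have h1 : s * q ≤ 0 := mul_nonpos_of_nonpos_of_nonneg hs (by positivity)
      have h2 : t * f ≤ 0 := mul_nonpos_of_nonpos_of_nonneg (by omega) (by positivity)
      omega
  · rintro ⟨j, hj⟩
    set t := ⌊((j + 1 : ℕ) : ℝ) * γ⌋ with ht
    have h1 : (t : ℝ) < (j + 1 : ℕ) * γ := by
      refine lt_of_le_of_ne (Int.floor_le _) ?_
      exact ((hγ.natCast_mul (Nat.succ_ne_zero j)).ne_int _).symm
    have h2 : ((j + 1 : ℕ) : ℝ) * γ < t + 1 := Int.lt_floor_add_one _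
    refine ⟨((j + 1 : ℕ) - t) * pm + t * fm, ?_⟩
    have e : (σ : ℝ) * (N * α - (((j + 1 : ℕ) - t) * pm + t * fm : ℤ)) =
        (j + 1 : ℕ) * (σ * (q * α - pm)) - t * (σ * (q * α - pm) + σ * (fm - f * α)) := by
      rw [hj]
      push_cast
      ring
    rw [e]
    generalize (σ : ℝ) * (q * α - pm) = A at *
    generalize (σ : ℝ) * (fm - f * α) = B at *
    have hAB : 0 < A + B := by linarith
    have h3 := mul_lt_mul_of_pos_right h1 hAB
    have h4 := mul_lt_mul_of_pos_right h2 hAB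
    rw [mul_assoc, hγA] at h3 h4
    constructor <;> linarith

end Strip

/-! ### Occurrences of a factor -/

/-- An increasing sequence with range `S` enumerates `S`. -/
theorem nth_eq_of_strictMono {S : ℕ → Prop} {g : ℕ → ℕ} (hg : StrictMono g)
    (hS : ∀ p, S p ↔ ∃ j, g j = p) : Nat.nth S = g := by
  have hr : Set.ofPred S = Set.range g := Set.ext hS
  have hinf : (Set.ofPred S).Infinite := hr ▸ Set.infinite_range_of_injective hg.injective
  rw [← (Nat.nth_strictMono hinf).range_inj hg, Nat.range_nth_of_infinite hinf]
  exact hr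

/-- The occurrences of a factor `u` of `c_α` attached to a unimodular pair of vectors `(q, pm)`,
`(f, fm)` lying on both sides of the line of slope `α`, where `u` is cut at `i₀` and `j₀` such
that `i₀ + j₀ = |u|`, `j₀ - i₀ = f - q`, and the number of letters `b` between the cuts is given by `hW`. -/
theorem occ_of_unimodular {α : ℝ} {q f : ℕ} {pm fm σ : ℤ}
    (hσ : σ = 1 ∨ σ = -1) (hirr : Irrational α)
    (hA : 0 < (σ : ℝ) * (q * α - pm)) (hB : 0 < (σ : ℝ) * (fm - f * α))
    (hdet : q * fm - pm * f = σ) {i₀ j₀ : ℕ} (hi : i₀ < q) (hij : i₀ + f = j₀ + q)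
    {u : List Letter} (hu : u.length = i₀ + j₀) (hfac : IsFactor (charWord α) u)
    (hW : ∀ p, OccursAt (charWord α) u p →
      ⌊((p + 1 + j₀ : ℕ) : ℝ) * α⌋ - ⌊((p + 1 + i₀ : ℕ) : ℝ) * α⌋ = fm - pm - σ)
    {γ : ℝ} (hγ : Irrational γ)
    (hγA : γ * (σ * (q * α - pm) + σ * (fm - f * α)) = σ * (q * α - pm)) :
    occ (charWord α) u 1 + 1 + i₀ = q ∧ ∃ P : ℕ → ℕ, GivenBy P γ q f ∧
      ∀ i, 1 ≤ i → occ (charWord α) u (i + 1) = occ (charWord α) u i + P i := by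
  obtain ⟨hγ0, hγ1⟩ : 0 < γ ∧ γ < 1 := by
    constructor <;> nlinarith
  have hf : 0 < f := by omega
  -- the cut position `i₀` of the `(j + 1)`-st occurrence
  set N : ℕ → ℤ := fun j => ((j + 1 : ℕ) : ℤ) * q + ⌊((j + 1 : ℕ) : ℝ) * γ⌋ * (f - q) with hNdef
  have hfl : ∀ j : ℕ, ⌊((j + 2 : ℕ) : ℝ) * γ⌋ - ⌊((j + 1 : ℕ) : ℝ) * γ⌋ = 0 ∨
      ⌊((j + 2 : ℕ) : ℝ) * γ⌋ - ⌊((j + 1 : ℕ) : ℝ) * γ⌋ = 1 := by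
    intro j
    have e : ((j + 2 : ℕ) : ℝ) * γ = ((j + 1 : ℕ) : ℝ) * γ + γ := by push_cast; ring
    rw [e]
    exact floor_add_sub_floor_mem hγ0 hγ1 _
  have hN0 : N 0 = q := by
    have : ⌊γ⌋ = 0 := Int.floor_eq_zero_iff.2 ⟨hγ0.le, hγ1⟩
    simp [hNdef, this]
  have hstep : ∀ j, N (j + 1) = N j + (match charWord γ j with
      | Letter.a => q
      | Letter.b => f : ℕ) := by
    intro j
    have hw := weight_charWord hγ0 hγ1 j
    have e : N (j + 1) = N j + q +
        (⌊((j + 2 : ℕ) : ℝ) * γ⌋ - ⌊((j + 1 : ℕ) : ℝ) * γ⌋) * (f - q) := by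
      simp only [hNdef]
      push_cast
      ring_nf
    rw [e, ← hw]
    cases charWord γ j <;> simp [Letter.weight]
  have hNq : ∀ j, (q : ℤ) ≤ N j := by
    intro j
    induction j with
    | zero => rw [hN0]
    | succ j ih => rw [hstep]; omega
  set g : ℕ → ℕ := fun j => (N j - 1 - i₀).toNat with hgdef
  have hg : ∀ j, (g j : ℤ) = N j - 1 - i₀ := by
    intro j
    have := hNq j
    simp only [hgdef]
    omega
  have hgstep : ∀ j, g (j + 1) = g j + (match charWord γ j with
      | Letter.a => q
      | Letter.b => f : ℕ) := by
    intro j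
    have h1 := hstep j
    have h2 := hg j
    have h3 := hg (j + 1)
    omega
  have hmono : StrictMono g := by
    refine strictMono_nat_of_lt_succ fun j => ?_
    rw [hgstep]
    cases charWord γ j <;> simp <;> omega
  have hocc : ∀ p, OccursAt (charWord α) u p ↔ ∃ j, g j = p := by
    intro p
    have hstrip := strip_iff_exists hσ hA hB hdet hγ hγA (N := ((p + 1 + i₀ : ℕ) : ℤ)) (by omega)
    rw [show ((((p + 1 + i₀ : ℕ) : ℤ)) : ℝ) = ((p + 1 + i₀ : ℕ) : ℝ) by push_cast; rfl] at hstrip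
    have hNg : (∃ j : ℕ, ((p + 1 + i₀ : ℕ) : ℤ) = N j) ↔ ∃ j, g j = p := by
      refine exists_congr fun j => ?_
      have := hg j
      omega
    rw [← hNg, ← hstrip]
    constructor
    · intro h
      exact exists_strip hσ hirr hij (hW p h)
    · rintro ⟨m, hp0, hp1⟩
      obtain ⟨r, hr⟩ := hfac
      obtain ⟨n, hr0, hr1⟩ := exists_strip hσ hirr hij (hW r hr)
      exact occursAt_of_strip hσ hirr hA hB hdet hi hij hu hr hr0 hr1 hp0 hp1
  have hnth := nth_eq_of_strictMono hmono hocc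
  refine ⟨?_, fun i => match charWord γ (i - 1) with
      | Letter.a => q
      | Letter.b => f, fun i _ => rfl, ?_⟩
  · have h1 := hg 0
    rw [hN0] at h1
    simp only [occ, hnth, Nat.sub_self]
    omega
  · intro i hi
    obtain ⟨j, rfl⟩ : ∃ j, i = j + 1 := ⟨i - 1, by omega⟩
    simp only [occ, hnth, Nat.add_sub_cancel]
    exact hgstep j


/-! ### Convergents -/

/-- The numerators `pₙ` of the convergents: `p₀ = 0`, `p₁ = 1`, `pₙ = aₙ pₙ₋₁ + pₙ₋₂`. -/
noncomputable def num (γ : ℝ) : ℕ → ℕ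
  | 0 => 0
  | 1 => 1
  | n + 2 => quot γ (n + 2) * num γ (n + 1) + num γ n

/-- The distances `|qₙ γ - pₙ|`, indexed from `-1`: `err γ (n + 1) = |qₙ γ - pₙ|`, as products of
iterates of the Gauss map. -/
noncomputable def err (γ : ℝ) : ℕ → ℝ
  | 0 => 1
  | n + 1 => err γ n * gauss^[n] γ

section Convergents

variable {γ : ℝ}

theorem gauss_iterate_pos (hγ : Irrational γ) (h0 : 0 < γ) (n : ℕ) : 0 < gauss^[n] γ := by
  cases n with
  | zero => simpa using h0
  | succ n =>
    rw [Function.iterate_succ_apply']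
    exact (gauss_mem (gauss_iterate_irrational hγ n)).2.1

theorem gauss_iterate_lt_one (hγ : Irrational γ) (h1 : γ < 1) (n : ℕ) : gauss^[n] γ < 1 := by
  cases n with
  | zero => simpa using h1
  | succ n =>
    rw [Function.iterate_succ_apply']
    exact (gauss_mem (gauss_iterate_irrational hγ n)).2.2

theorem inv_gauss_iterate (hγ : Irrational γ) (h0 : 0 < γ) (n : ℕ) :
    (gauss^[n] γ)⁻¹ = quot γ (n + 1) + gauss^[n + 1] γ := by
  rw [Function.iterate_succ_apply', gauss, quot, Nat.add_sub_cancel,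
    natCast_floor_eq_intCast_floor (inv_nonneg.2 (gauss_iterate_pos hγ h0 n).le)]
  exact (Int.floor_add_fract _).symm

theorem one_le_quot (hγ : Irrational γ) (h0 : 0 < γ) (h1 : γ < 1) (n : ℕ) :
    1 ≤ quot γ (n + 1) := by
  rw [quot, Nat.add_sub_cancel, Nat.le_floor_iff' one_ne_zero, Nat.cast_one]
  exact (one_lt_inv₀ (gauss_iterate_pos hγ h0 n)).2 (gauss_iterate_lt_one hγ h1 n) |>.le

theorem err_pos (hγ : Irrational γ) (h0 : 0 < γ) (n : ℕ) : 0 < err γ n := by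
  induction n with
  | zero => exact one_pos
  | succ n ih => exact mul_pos ih (gauss_iterate_pos hγ h0 n)

theorem err_eq (hγ : Irrational γ) (h0 : 0 < γ) (n : ℕ) :
    err γ n = (quot γ (n + 1) + gauss^[n + 1] γ) * err γ (n + 1) := by
  have := (gauss_iterate_pos hγ h0 n).ne'
  rw [← inv_gauss_iterate hγ h0, err]
  field_simp

theorem den_mul_sub_num (hγ : Irrational γ) (h0 : 0 < γ) (n : ℕ) :
    den γ n * γ - num γ n = (-1) ^ n * err γ (n + 1) := by
  have hrec : ∀ n, err γ (n + 2) = err γ n - quot γ (n + 1) * err γ (n + 1) := by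
    intro n
    rw [err_eq hγ h0 n, err]
    ring
  induction n using Nat.twoStepInduction with
  | zero => simp [den, num, err]
  | one => rw [hrec]; simp [den, num, err]
  | more n ih1 ih2 =>
    rw [hrec, den, num]
    push_cast
    rw [pow_succ] at ih2 ⊢
    rw [pow_succ]
    linear_combination (quot γ (n + 2) : ℝ) * ih2 + ih1

theorem den_num_det (n : ℕ) :
    (den γ (n + 1) * num γ n - num γ (n + 1) * den γ n : ℤ) = (-1) ^ (n + 1) := by
  induction n with
  | zero => simp [den, num]
  | succ n ih =>
    rw [den, num, pow_succ, ← ih]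
    push_cast
    ring

/-- The slope of the coding of the gaps is the ratio of the heights of the two lattice vectors. -/
theorem shift_mul_err (hγ : Irrational γ) (h0 : 0 < γ) (n : ℕ) (k : ℤ)
    (hk : 1 ≤ (quot γ (n + 1) : ℤ) + k) :
    shift γ n k * (err γ n + k * err γ (n + 1)) = err γ (n + 1) := by
  have hk' : (1 : ℝ) ≤ quot γ (n + 1) + k := by exact_mod_cast hk
  have hx := gauss_iterate_pos hγ h0 (n + 1)
  have : (quot γ (n + 1) : ℝ) + k + gauss^[n + 1] γ ≠ 0 := by linarith
  rw [shift, err_eq hγ h0 n]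
  field_simp
  ring

end Convergents

/-! ### Lengths and weights of the singular words -/

section Words

variable {α : ℝ}

theorem directive_succ_succ (n : ℕ) : directive α (n + 2) = quot α (n + 2) := by
  simp [directive]

theorem one_le_directive (hirr : Irrational α) (h0 : 0 < α) (h1 : α < 1)
    (hd : 1 ≤ directive α 1) (n : ℕ) : 1 ≤ directive α (n + 1) := by
  cases n with
  | zero => exact hd
  | succ n => rw [directive_succ_succ]; exact one_le_quot hirr h0 h1 _

theorem quot_one (hd : 1 ≤ directive α 1) : quot α 1 = directive α 1 + 1 := by
  simp only [directive, if_true] at hd ⊢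
  omega

theorem length_stdWord (hd : 1 ≤ directive α 1) (n : ℕ) :
    (stdWord (directive α) (n + 1)).length = den α n := by
  induction n using Nat.twoStepInduction with
  | zero => simp [stdWord, den]
  | one => simp [stdWord, den, length_wpow, quot_one hd]
  | more n ih1 ih2 =>
    rw [stdWord, List.length_append, length_wpow, ih1, ih2, directive_succ_succ, den]

theorem weight_stdWord (n : ℕ) : weight (stdWord (directive α) (n + 1)) = num α n := by
  induction n using Nat.twoStepInduction with
  | zero => simp [stdWord, num, weight, Letter.weight]
  | one => simp [stdWord, num, weight_append, weight_wpow]; simp [weight, Letter.weight]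
  | more n ih1 ih2 =>
    rw [stdWord, weight_append, weight_wpow, ih1, ih2, directive_succ_succ, num]
    push_cast
    rfl

theorem length_cons_dropLast (c c' : Letter) (z : List Letter) :
    (c :: (z ++ [c']).dropLast).length = (z ++ [c']).length := by
  simp

theorem weight_cons_dropLast (c c' : Letter) (z : List Letter) :
    weight (c :: (z ++ [c']).dropLast) = weight (z ++ [c']) + c.weight - c'.weight := by
  simp [weight]
  ring

theorem length_singWord (hd : 1 ≤ directive α 1) (n : ℕ) :
    (singWord (directive α) (n + 2)).length = den α n := by
  have h := stdWord_eq_append (directive α) (n + 1)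
  rw [singWord, h, length_cons_dropLast, ← h, length_stdWord hd]

theorem weight_singWord (n : ℕ) :
    weight (singWord (directive α) (n + 2)) = num α n - (-1) ^ (n + 1) := by
  have h := stdWord_eq_append (directive α) (n + 1)
  rw [singWord, h, weight_cons_dropLast, ← h, weight_stdWord]
  rcases Nat.even_or_odd (n + 1) with hn | hn
  · simp [hn, hn.neg_one_pow, Letter.weight]
  · simp [Nat.not_even_iff_odd.2 hn, hn.neg_one_pow, Letter.weight]

theorem stdWord_eq_append_of_pos {d : ℕ → ℕ} {n : ℕ} (hn : 1 ≤ d (n + 1)) :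
    stdWord d (n + 2) =
      stdWord d (n + 1) ++ (wpow (stdWord d (n + 1)) (d (n + 1) - 1) ++ stdWord d n) := by
  obtain ⟨e, he⟩ : ∃ e, d (n + 1) = e + 1 := ⟨d (n + 1) - 1, by omega⟩
  simp [stdWord, he, wpow, List.replicate_succ]

theorem length_adjWord (hirr : Irrational α) (h0 : 0 < α) (h1 : α < 1)
    (hd : 1 ≤ directive α 1) (n : ℕ) :
    (adjWord (directive α) (n + 1)).length + den α n = den α (n + 1) := by
  have h := stdWord_eq_append (directive α) n
  have h2 := congrArg List.length
    (stdWord_eq_append_of_pos (one_le_directive hirr h0 h1 hd n))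
  rw [List.length_append, length_stdWord hd, length_stdWord hd] at h2
  rw [adjWord, h, ← List.append_assoc, length_cons_dropLast, List.append_assoc, ← h]
  omega

theorem weight_adjWord (hirr : Irrational α) (h0 : 0 < α) (h1 : α < 1)
    (hd : 1 ≤ directive α 1) (n : ℕ) :
    weight (adjWord (directive α) (n + 1)) = num α (n + 1) - num α n + (-1) ^ (n + 1) := by
  have h := stdWord_eq_append (directive α) n
  have h2 := congrArg weight
    (stdWord_eq_append_of_pos (one_le_directive hirr h0 h1 hd n))
  rw [weight_append, weight_stdWord, weight_stdWord] at h2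
  rw [adjWord, h, ← List.append_assoc, weight_cons_dropLast, List.append_assoc, ← h, h2]
  rcases Nat.even_or_odd n with hn | hn
  · simp [hn, hn.add_one.neg_one_pow, Letter.weight]
    ring
  · simp [Nat.not_even_iff_odd.2 hn, hn.add_one.neg_one_pow, Letter.weight]

theorem length_U (hirr : Irrational α) (h0 : 0 < α) (h1 : α < 1)
    (hd : 1 ≤ directive α 1) (n k : ℕ) :
    (U (directive α) (n + 1) k).length = k * den α (n + 1) + den α n := by
  rw [U, List.length_append, length_wpow, List.length_append, length_singWord hd,
    ← length_adjWord hirr h0 h1 hd n]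
  ring

theorem weight_U (hirr : Irrational α) (h0 : 0 < α) (h1 : α < 1)
    (hd : 1 ≤ directive α 1) (n k : ℕ) :
    weight (U (directive α) (n + 1) k) = k * num α (n + 1) + num α n - (-1) ^ (n + 1) := by
  rw [U, weight_append, weight_wpow, weight_append, weight_singWord,
    weight_adjWord hirr h0 h1 hd n]
  ring

theorem wpow_append_comm (x y : List Letter) (k : ℕ) :
    wpow (x ++ y) (k + 1) = x ++ wpow (y ++ x) k ++ y := by
  induction k with
  | zero => simp [wpow]
  | succ k ih =>
    have h : ∀ (w : List Letter) (k : ℕ), wpow w (k + 1) = w ++ wpow w k := by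
      intro w k; simp [wpow, List.replicate_succ]
    rw [h, ih, h]
    simp

/-- `Ū_{n,k+1} = vₙ₋₂ U_{n,k} vₙ₋₂`. -/
theorem Ubar_succ (d : ℕ → ℕ) (n k : ℕ) :
    Ubar d n (k + 1) = adjWord d n ++ U d n k ++ adjWord d n := by
  simp [Ubar, U, wpow_append_comm]

end Words

/-! ### Occurrences of palindromes -/

section Palindromes

variable {α : ℝ}

/-- The occurrences of a factor of `c_α` with the word `U_{n+1,k}` in its middle. -/
theorem occ_of_U_mid (hirr : Irrational α) (h0 : 0 < α) (h1 : α < 1)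
    (hd : 1 ≤ directive α 1) {n k : ℕ} (hk : k + 2 ≤ directive α (n + 2))
    {x y : List Letter} (hxy : y.length = x.length) (hx : x.length < den α (n + 1))
    (hfac : IsFactor (charWord α) (x ++ U (directive α) (n + 1) k ++ y)) :
    occ (charWord α) (x ++ U (directive α) (n + 1) k ++ y) 1 + 1 + x.length = den α (n + 1) ∧
    ∃ P : ℕ → ℕ, GivenBy P (shift α (n + 1) (-(k : ℤ)))
        (den α (n + 1)) ((k + 1) * den α (n + 1) + den α n) ∧
      ∀ i, 1 ≤ i → occ (charWord α) (x ++ U (directive α) (n + 1) k ++ y) (i + 1) =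
        occ (charWord α) (x ++ U (directive α) (n + 1) k ++ y) i + P i := by
  rw [directive_succ_succ] at hk
  have hL := length_U hirr h0 h1 hd n k
  have hwt := weight_U hirr h0 h1 hd n k
  have hquot : 1 ≤ (quot α (n + 1 + 1) : ℤ) + -(k : ℤ) := by
    rw [show n + 1 + 1 = n + 2 from rfl]
    omega
  have hε := den_mul_sub_num hirr h0 (n + 1)
  have hε' := den_mul_sub_num hirr h0 n
  have hsq : ((-1 : ℝ) ^ n) * (-1) ^ n = 1 := by rw [← mul_pow]; simp
  have heq := err_eq hirr h0 (n + 1)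
  have hpos := err_pos hirr h0 (n + 2)
  have hshift := shift_mul_err hirr h0 (n + 1) (-(k : ℤ)) hquot
  have hA : (((-1) ^ (n + 1) : ℤ) : ℝ) * (den α (n + 1) * α - ((num α (n + 1) : ℤ) : ℝ)) =
      err α (n + 2) := by
    rw [pow_succ] at hε ⊢
    push_cast
    linear_combination (-(-1 : ℝ) ^ n) * hε + err α (n + 2) * hsq
  have hB : (((-1) ^ (n + 1) : ℤ) : ℝ) * ((((k + 1) * num α (n + 1) + num α n : ℤ)) -
      (((k + 1) * den α (n + 1) + den α n : ℕ)) * α) =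
      err α (n + 1) - (k + 1) * err α (n + 2) := by
    rw [pow_succ] at hε ⊢
    push_cast
    linear_combination ((-1 : ℝ) ^ n) * hε' + (k + 1) * (-1 : ℝ) ^ n * hε +
      (err α (n + 1) - (k + 1) * err α (n + 2)) * hsq
  refine occ_of_unimodular (pm := num α (n + 1)) (fm := (k + 1) * num α (n + 1) + num α n)
    (σ := (-1) ^ (n + 1)) (j₀ := x.length + (U (directive α) (n + 1) k).length)
    (neg_one_pow_eq_or ℤ _) hirr ?_ ?_ ?_ hx ?_ ?_ hfac ?_
    (shift_spec hirr (n + 1) (-(k : ℤ)) hquot).1 ?_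
  · rw [hA]; exact hpos
  · rw [hB, heq]
    have : (k : ℝ) + 2 ≤ quot α (n + 1 + 1) := by exact_mod_cast hk
    have hg := gauss_iterate_pos hirr h0 (n + 1 + 1)
    have : 0 < (quot α (n + 1 + 1) + gauss^[n + 1 + 1] α - (k + 1)) * err α (n + 2) :=
      mul_pos (by linarith) hpos
    linarith
  · rw [← den_num_det (γ := α) n]
    push_cast
    ring
  · rw [hL]; ring
  · simp only [List.length_append, hxy]; ring
  · intro p hp
    have := hp.append_left.append_right.weight_eq h0 h1
    rw [hwt] at this
    rw [show p + 1 + (x.length + (U (directive α) (n + 1) k).length) =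
        p + x.length + (U (directive α) (n + 1) k).length + 1 by ring,
      show p + 1 + x.length = p + x.length + 1 by ring, ← this]
    ring
  · rw [hA, hB]
    push_cast at hshift ⊢
    linear_combination hshift

/-- The occurrences of a factor of `c_α` with the word `v_{n-1}` in its middle. The second lattice
vector `(qₙ, pₙ)` is now the one with the smaller first coordinate, so the cut `i₀` comes after
the cut `j₀`, with `v_{n-1}` between them. -/
theorem occ_of_adjWord_mid (hirr : Irrational α) (h0 : 0 < α) (h1 : α < 1)
    (hd : 1 ≤ directive α 1) {n : ℕ}
    {x y : List Letter} (hxy : y.length = x.length) (hx : x.length < den α n)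
    (hfac : IsFactor (charWord α) (x ++ adjWord (directive α) (n + 1) ++ y)) :
    occ (charWord α) (x ++ adjWord (directive α) (n + 1) ++ y) 1 + 1 + x.length = den α n ∧
    ∃ P : ℕ → ℕ, GivenBy P (shift α (n + 1) 1) (den α (n + 1)) (den α n) ∧
      ∀ i, 1 ≤ i → occ (charWord α) (x ++ adjWord (directive α) (n + 1) ++ y) (i + 1) =
        occ (charWord α) (x ++ adjWord (directive α) (n + 1) ++ y) i + P i := by
  have hL := length_adjWord hirr h0 h1 hd n
  have hwt := weight_adjWord hirr h0 h1 hd n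
  have hquot : 1 ≤ (quot α (n + 1 + 1) : ℤ) + 1 := by omega
  have hε := den_mul_sub_num hirr h0 (n + 1)
  have hε' := den_mul_sub_num hirr h0 n
  have hsq : ((-1 : ℝ) ^ n) * (-1) ^ n = 1 := by rw [← mul_pow]; simp
  have hshift := shift_mul_err hirr h0 (n + 1) 1 hquot
  have hA : (((-1) ^ (n + 1) : ℤ) : ℝ) * (den α (n + 1) * α - ((num α (n + 1) : ℤ) : ℝ)) =
      err α (n + 2) := by
    rw [pow_succ] at hε ⊢
    push_cast
    linear_combination (-(-1 : ℝ) ^ n) * hε + err α (n + 2) * hsq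
  have hB : (((-1) ^ (n + 1) : ℤ) : ℝ) * (((num α n : ℤ) : ℝ) - den α n * α) =
      err α (n + 1) := by
    rw [pow_succ]
    push_cast
    linear_combination ((-1 : ℝ) ^ n) * hε' + err α (n + 1) * hsq
  have hmain := occ_of_unimodular (pm := num α (n + 1)) (fm := num α n) (f := den α n)
    (q := den α (n + 1)) (σ := (-1) ^ (n + 1)) (j₀ := x.length)
    (i₀ := x.length + (adjWord (directive α) (n + 1)).length)
    (neg_one_pow_eq_or ℤ _) hirr (by rw [hA]; exact err_pos hirr h0 _)
    (by rw [hB]; exact err_pos hirr h0 _) (den_num_det n) (by omega) (by omega)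
    (by simp only [List.length_append, hxy]) hfac ?_
    (shift_spec hirr (n + 1) 1 hquot).1 ?_
  · exact ⟨by omega, hmain.2⟩
  · intro p hp
    have := hp.append_left.append_right.weight_eq h0 h1
    rw [hwt] at this
    rw [show p + 1 + (x.length + (adjWord (directive α) (n + 1)).length) =
        p + x.length + (adjWord (directive α) (n + 1)).length + 1 by ring,
      show p + 1 + x.length = p + x.length + 1 by ring]
    linarith
  · rw [hA, hB]
    push_cast at hshift ⊢
    linear_combination hshift

/-- The occurrences of `a ^ k`, which plays the part of `U_{0,k}`. -/
theorem occ_replicate_a (hirr : Irrational α) (h0 : 0 < α) (h1 : α < 1) {k : ℕ}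
    (hk : k + 1 ≤ directive α 1) (hfac : IsFactor (charWord α) (List.replicate k Letter.a)) :
    occ (charWord α) (List.replicate k Letter.a) 1 = 0 ∧
    ∃ P : ℕ → ℕ, GivenBy P (shift α 0 (-(k : ℤ))) 1 (k + 1) ∧
      ∀ i, 1 ≤ i → occ (charWord α) (List.replicate k Letter.a) (i + 1) =
        occ (charWord α) (List.replicate k Letter.a) i + P i := by
  have hquot1 : quot α 1 = directive α 1 + 1 := quot_one (by omega)
  have hquot : 1 ≤ (quot α (0 + 1) : ℤ) + -(k : ℤ) := by
    rw [zero_add]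
    omega
  have hshift := shift_mul_err hirr h0 0 (-(k : ℤ)) hquot
  have hmain := occ_of_unimodular (pm := 0) (fm := 1) (f := k + 1) (q := 1) (σ := 1) (j₀ := k)
    (i₀ := 0) (Or.inl rfl) hirr (by simpa using h0) ?_ (by simp) one_pos (by omega)
    (by simp) hfac ?_ (shift_spec hirr 0 (-(k : ℤ)) hquot).1 ?_
  · exact ⟨by omega, hmain.2⟩
  · have h := inv_gauss_iterate hirr h0 0
    have hg := gauss_iterate_pos hirr h0 (0 + 1)
    rw [zero_add, hquot1] at h
    have hk' : (k : ℝ) + 1 ≤ directive α 1 := by exact_mod_cast hk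
    have h2 : (k : ℝ) + 1 < α⁻¹ := by
      rw [show α⁻¹ = (gauss^[0] α)⁻¹ from rfl, h]
      push_cast
      linarith
    rw [lt_inv_comm₀ (by positivity) h0, ← one_div, lt_div_iff₀ (by positivity)] at h2
    push_cast
    linarith
  · intro p hp
    have := hp.weight_eq h0 h1
    have hw : weight (List.replicate k Letter.a) = 0 := by simp [weight, Letter.weight]
    rw [hw, List.length_replicate] at this
    rw [show p + 1 + k = p + k + 1 by ring, show p + 1 + 0 = p + 1 by ring, ← this]
    ring
  · simp only [err, Function.iterate_zero, id] at hshift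
    push_cast at hshift ⊢
    linear_combination hshift

end Palindromes

end Sturmian

theorem mainTheorem2 (α : ℝ) (hirr : Irrational α) (h0 : 0 < α) (h1 : α < 1)
    (hd : 1 ≤ Sturmian.directive α 1)
    (u : List Sturmian.Letter) (hpal : u.Palindrome)
    (hfac : Sturmian.IsFactor (Sturmian.charWord α) u) (hlen : 2 ≤ u.length) :
    (∀ (n k : ℕ) (v : List Sturmian.Letter), 1 ≤ n →
      v <:+ Sturmian.adjWord (Sturmian.directive α) n →
      v ≠ Sturmian.adjWord (Sturmian.directive α) n →
      k + 2 ≤ Sturmian.directive α (n + 1) →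
      u = v ++ Sturmian.U (Sturmian.directive α) n k ++ v.reverse →
        (Sturmian.occ (Sturmian.charWord α) u 1 : ℚ) =
          1 / 2 * (((k : ℚ) + 2) * Sturmian.den α n + Sturmian.den α (n - 1) - u.length - 2) ∧
        ∃ P : ℕ → ℕ,
          Sturmian.GivenBy P (Sturmian.shift α n (-(k : ℤ)))
            (Sturmian.den α n) ((k + 1) * Sturmian.den α n + Sturmian.den α (n - 1)) ∧
          ∀ i, 1 ≤ i → Sturmian.occ (Sturmian.charWord α) u (i + 1) =
            Sturmian.occ (Sturmian.charWord α) u i + P i) ∧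
    (∀ (n k : ℕ) (v : List Sturmian.Letter), 1 ≤ n →
      v <:+ Sturmian.singWord (Sturmian.directive α) (n + 1) →
      v ≠ Sturmian.singWord (Sturmian.directive α) (n + 1) →
      k + 1 ≤ Sturmian.directive α (n + 1) →
      u = v ++ Sturmian.Ubar (Sturmian.directive α) n k ++ v.reverse →
        (Sturmian.occ (Sturmian.charWord α) u 1 : ℚ) =
          1 / 2 * (((k : ℚ) + 1) * Sturmian.den α n + Sturmian.den α (n - 1) - u.length - 2) ∧
        ∃ P : ℕ → ℕ,
          Sturmian.GivenBy P (Sturmian.shift α n (1 - (k : ℤ)))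
            (Sturmian.den α n) (k * Sturmian.den α n + Sturmian.den α (n - 1)) ∧
          ∀ i, 1 ≤ i → Sturmian.occ (Sturmian.charWord α) u (i + 1) =
            Sturmian.occ (Sturmian.charWord α) u i + P i) ∧
    (∀ k : ℕ, 2 ≤ k → k + 1 ≤ Sturmian.directive α 1 → u = List.replicate k Sturmian.Letter.a →
        Sturmian.occ (Sturmian.charWord α) u 1 = 0 ∧
        ∃ P : ℕ → ℕ,
          Sturmian.GivenBy P (Sturmian.shift α 0 (-(k : ℤ))) 1 (k + 1) ∧
          ∀ i, 1 ≤ i → Sturmian.occ (Sturmian.charWord α) u (i + 1) =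
            Sturmian.occ (Sturmian.charWord α) u i + P i) := by
  refine ⟨?_, ?_, ?_⟩
  · rintro n k v hn hsuf hne hk rfl
    obtain ⟨n, rfl⟩ : ∃ m, n = m + 1 := ⟨n - 1, by omega⟩
    have hlt : v.length < (Sturmian.adjWord (Sturmian.directive α) (n + 1)).length :=
      lt_of_le_of_ne hsuf.length_le fun h => hne (hsuf.eq_of_length h)
    have hadj := Sturmian.length_adjWord hirr h0 h1 hd n
    have hL := Sturmian.length_U hirr h0 h1 hd n k
    obtain ⟨hfst, hP⟩ := Sturmian.occ_of_U_mid hirr h0 h1 hd hk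
      v.length_reverse (by omega) hfac
    refine ⟨?_, hP⟩
    simp only [List.length_append, List.length_reverse, hL, Nat.add_sub_cancel]
    rw [← hfst]
    push_cast
    ring
  · rintro n k v hn hsuf hne hk rfl
    obtain ⟨n, rfl⟩ : ∃ m, n = m + 1 := ⟨n - 1, by omega⟩
    have hlt : v.length < (Sturmian.singWord (Sturmian.directive α) (n + 2)).length :=
      lt_of_le_of_ne hsuf.length_le fun h => hne (hsuf.eq_of_length h)
    have hadj := Sturmian.length_adjWord hirr h0 h1 hd n
    rw [Sturmian.length_singWord hd] at hlt
    cases k with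
    | zero =>
      have hU : Sturmian.Ubar (Sturmian.directive α) (n + 1) 0 =
          Sturmian.adjWord (Sturmian.directive α) (n + 1) := by
        simp [Sturmian.Ubar, Sturmian.wpow]
      rw [hU] at hfac ⊢
      obtain ⟨hfst, hP⟩ := Sturmian.occ_of_adjWord_mid hirr h0 h1 hd v.length_reverse hlt hfac
      refine ⟨?_, by simpa using hP⟩
      simp only [List.length_append, List.length_reverse, Nat.add_sub_cancel]
      rw [← hadj, ← hfst]
      push_cast
      ring
    | succ k =>
      have hL := Sturmian.length_U hirr h0 h1 hd n k
      -- both copies of `vₙ₋₂` at the ends of `Ū_{n,k+1}` go to the outer part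
      have hU : v ++ Sturmian.Ubar (Sturmian.directive α) (n + 1) (k + 1) ++ v.reverse =
          (v ++ Sturmian.adjWord (Sturmian.directive α) (n + 1)) ++
            Sturmian.U (Sturmian.directive α) (n + 1) k ++
            (Sturmian.adjWord (Sturmian.directive α) (n + 1) ++ v.reverse) := by
        simp [Sturmian.Ubar_succ]
      rw [hU] at hfac ⊢
      obtain ⟨hfst, hP⟩ := Sturmian.occ_of_U_mid hirr h0 h1 hd hk
        (by simp [add_comm]) (by rw [List.length_append]; omega) hfac
      refine ⟨?_, by simpa using hP⟩
      rw [List.length_append] at hfst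
      have hfst' := congrArg (Nat.cast : ℕ → ℚ) hfst
      push_cast at hfst'
      simp only [List.length_append, List.length_reverse, hL, Nat.add_sub_cancel]
      push_cast
      linear_combination hfst'
  · rintro k - hk rfl
    exact Sturmian.occ_replicate_a hirr h0 h1 hk hfac
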